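/- Let $\mathrm{Homeo}(\mathbb R)$ and $\mathrm{Homeo}(S^1)$ be the groups (under composition) of all homeomorphisms of the real line and of the unit circle. Let $\mathrm{Homeo}_+(\mathbb R)\le\mathrm{Homeo}(\mathbb R)$ be the subgroup of increasing homeomorphisms, and let $\mathrm{Homeo}_+(S^1)\le\mathrm{Homeo}(S^1)$ be the subgroup of orientation preserving homeomorphisms, i.e. those $f$ for which there is an increasing homeomorphism $F:\mathbb R\to\mathbb R$ with $e^{iF(t)}=f(e^{it})$ for all $t\in\mathbb R$. The index of a subgroup is the cardinality of its set of cosets. Then: 1. $\mathrm{Homeo}_+(\mathbb R)$ is the only proper subgroup of $\mathrm{Homeo}(\mathbb R)$ of index $<2^{\aleph_0}$; that is, a subgroup $H\le\mathrm{Homeo}(\mathbb R)$ satisfies $H\neq\mathrm{Homeo}(\mathbb R)$ and $[\mathrm{Homeo}(\mathbb R):H]<2^{\aleph_0}$ if and only if $H=\mathrm{Homeo}_+(\mathbb R)$. 2. $\mathrm{Homeo}_+(S^1)$ is, in the same sense, the only proper subgroup of $\mathrm{Homeo}(S^1)$ of index $<2^{\aleph_0}$. 3. In particular, $\mathrm{Homeo}_+(\mathbb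 R)$ has no proper subgroup of index $<2^{\aleph_0}$. -/

import Mathlib

/-- `Homeo₊(ℝ)`: the subgroup of increasing homeomorphisms in the group `ℝ ≃ₜ ℝ` of all
homeomorphisms of the real line (the group operation is composition). -/
def homeoPlusReal : Subgroup (ℝ ≃ₜ ℝ) where
  carrier := {f | StrictMono f}
  mul_mem' {f g} hf hg := show StrictMono (fun x => f (g x)) from StrictMono.comp hf hg
  one_mem' := show StrictMono (fun x : ℝ => x) from strictMono_id
  inv_mem' {f} hf := by
    intro x y hxy
    rw [← StrictMono.lt_iff_lt (f := f) hf]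
    simpa using hxy

/-- A homeomorphism of the unit circle is orientation preserving if it lifts, through the universal
covering map `t ↦ exp (i t)`, to an increasing homeomorphism of the real line. -/
def IsOrientationPreserving (f : Circle ≃ₜ Circle) : Prop :=
  ∃ F : ℝ ≃ₜ ℝ, StrictMono F ∧ ∀ t : ℝ, Circle.exp (F t) = f (Circle.exp t)

/-- `Homeo₊(S¹)`: the subgroup of orientation preserving homeomorphisms in the group
`Circle ≃ₜ Circle` of all homeomorphisms of the unit circle. -/
def homeoPlusCircle : Subgroup (Circle ≃ₜ Circle) where
  carrier := {f | IsOrientationPreserving f}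
  mul_mem' := by
    rintro f g ⟨F, hF, hf⟩ ⟨G, hG, hg⟩
    exact ⟨F * G, homeoPlusReal.mul_mem hF hG, fun t => by simp [hf, hg]⟩
  one_mem' := ⟨1, homeoPlusReal.one_mem, fun t => rfl⟩
  inv_mem' := by
    rintro f ⟨F, hF, hf⟩
    refine ⟨F⁻¹, homeoPlusReal.inv_mem hF, fun t => f.injective ?_⟩
    rw [← hf]
    simp

/-! The core is that Homeo₊(ℝ), modelled as `ℝ ≃o ℝ`, has no proper subgroup H of small index
(`Subgroup.SmallIndex.eq_top`). Pulling back along homomorphisms, every subgroup of small index of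
any group contains all images of `ℝ ≃o ℝ` (`map_mem`). This settles the line, as Homeo₊(ℝ) has index
two. On the circle, each orientation preserving map is a product of two maps with fixed points, and
those fixing a given point with a lift fixing a point above it form an image of `ℝ ≃o ℝ`.

For the core, maps moving every point right generate `ℝ ≃o ℝ` and are all conjugate to `translation
1`, so it suffices to find this translation in every H. A counting argument in a countable power
(`exists_mulSingle_mem`) puts into H all maps supported in the integer translates of some interval.
Small translations in H carry this to every short interval, hence to all maps fixing a grid p + δℤ.
Translation by δ/4 is a product of two such maps, for two different grids. -/

/-! ### Subgroups of small index -/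

section

open Cardinal

/-- A subgroup has small index if it has fewer than continuum many cosets. -/
def Subgroup.SmallIndex {G : Type} [Group G] (H : Subgroup G) : Prop :=
  #(G ⧸ H) < continuum

namespace Subgroup.SmallIndex

variable {G G' Q : Type} [Group G] [Group G'] [Group Q]

theorem comap {H : Subgroup G'} (hH : H.SmallIndex) (φ : G →* G') : (H.comap φ).SmallIndex := by
  refine lt_of_le_of_lt ?_ hH
  have key : ∀ a b : G, (a : G ⧸ H.comap φ) = b ↔ (φ a : G' ⧸ H) = φ b := fun a b => by
    simp [QuotientGroup.eq]
  refine mk_le_of_injective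
    (f := Quotient.lift (fun a : G => (φ a : G' ⧸ H)) fun a b h =>
      (key a b).1 (Quotient.sound h)) ?_
  intro x y
  induction x using Quotient.inductionOn
  induction y using Quotient.inductionOn
  exact fun h => (key _ _).2 h

theorem exists_ne_inv_mul_mem {α : Type} {H : Subgroup G} (hH : H.SmallIndex)
    (hα : continuum ≤ #α) (f : α → G) : ∃ a b, a ≠ b ∧ (f a)⁻¹ * f b ∈ H := by
  by_contra! h
  refine absurd (hα.trans (mk_le_of_injective (f := fun a => (f a : G ⧸ H)) ?_)) (not_le.2 hH)
  intro a b hab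
  by_contra hne
  exact h a b hne (QuotientGroup.eq.1 hab)

/-- If some `q n` were missed at every coordinate `n`, the continuum many sequences equal to `q` on
a set `A` and to 1 off it would lie in distinct cosets. -/
theorem exists_surjective_eval {K : Subgroup (ℕ → Q)} (hK : K.SmallIndex) :
    ∃ n, ∀ q, ∃ k ∈ K, k n = q := by
  classical
  by_contra! h
  choose q hq using h
  obtain ⟨A, B, hne, hmem⟩ := hK.exists_ne_inv_mul_mem (α := Set ℕ) (by simp)
    fun A n => if n ∈ A then q n else 1
  obtain ⟨n, hn⟩ : ∃ n, ¬ (n ∈ A ↔ n ∈ B) := by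
    by_contra! h
    exact hne (Set.ext h)
  by_cases hA : n ∈ A
  · have hB : n ∉ B := fun hB => hn (iff_of_true hA hB)
    exact hq n _ (K.inv_mem hmem) (by simp [hA, hB])
  · have hB : n ∈ B := by
      by_contra hB
      exact hn (iff_of_false hA hB)
    exact hq n _ hmem (by simp [hA, hB])

/-- If `Q` has no proper normal subgroup of small index, then a subgroup of small index of the
power `ℕ → Q` contains one of the factors. -/
theorem exists_mulSingle_mem {K : Subgroup (ℕ → Q)} (hK : K.SmallIndex)
    (hQ : ∀ N : Subgroup Q, N.Normal → N.SmallIndex → N = ⊤) :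
    ∃ n, ∀ q : Q, Pi.mulSingle n q ∈ K := by
  obtain ⟨n, hn⟩ := hK.exists_surjective_eval
  have htop := hQ (K.comap (MonoidHom.mulSingle (fun _ : ℕ => Q) n)) ?_ (hK.comap _)
  · exact ⟨n, fun q => by
      have : q ∈ K.comap (MonoidHom.mulSingle (fun _ : ℕ => Q) n) := htop ▸ mem_top q
      simpa using this⟩
  -- Conjugating an element of the `n`-th factor only sees the `n`-th coordinate, and every
  -- coordinate `p` is attained inside `K`.
  · refine ⟨fun q hq p => ?_⟩
    obtain ⟨k, hk, rfl⟩ := hn p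
    rw [mem_comap] at hq ⊢
    convert K.mul_mem (K.mul_mem hk hq) (K.inv_mem hk) using 1
    ext m
    rcases eq_or_ne m n with rfl | hm
    · simp
    · simp [hm]

end Subgroup.SmallIndex

/-- If `P` has index two and lies in every subgroup of small index, then it is the only proper
subgroup of small index. -/
theorem Subgroup.ne_top_and_smallIndex_iff {G : Type} [Group G] {P : Subgroup G} {c : G}
    (hc : c ∉ P) (hcP : ∀ g, g ∈ P ∨ c * g ∈ P)
    (hP : ∀ H : Subgroup G, H.SmallIndex → P ≤ H) (H : Subgroup G) :
    (H ≠ ⊤ ∧ H.SmallIndex) ↔ H = P := by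
  constructor
  · rintro ⟨hne, hH⟩
    refine le_antisymm (fun g hg => (hcP g).resolve_right fun hcg => hne ?_) (hP H hH)
    have hcH : c ∈ H := by simpa using H.mul_mem (hP H hH hcg) (H.inv_mem hg)
    refine (eq_top_iff' H).2 fun x => ?_
    rcases hcP x with hx | hx
    · exact hP H hH hx
    · simpa using H.mul_mem (H.inv_mem hcH) (hP H hH hx)
  · rintro rfl
    refine ⟨fun h => hc (h ▸ mem_top c), ?_⟩
    have hsurj : Function.Surjective
        (fun b : Bool => if b then ((1 : G) : G ⧸ H) else ((c⁻¹ : G) : G ⧸ H)) := by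
      intro x
      induction x using QuotientGroup.induction_on with | _ g => ?_
      rcases hcP g with hg | hg
      · exact ⟨true, by simpa [QuotientGroup.eq] using hg⟩
      · exact ⟨false, by simpa [QuotientGroup.eq] using hg⟩
    exact (mk_le_of_surjective hsurj).trans_lt
      ((lt_aleph0_of_finite Bool).trans aleph0_lt_continuum)

end

/-! ### Charts of intervals and gluing -/

section

open Set

/-- The increasing bijection of `ℝ` onto the open interval `(a, b)`. -/
noncomputable def chart (a b y : ℝ) : ℝ :=
  a + (b - a) * ((1 + (orderIsoIooNegOneOne ℝ y : ℝ)) / 2)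

/-- Translated intervals share their coordinate, so gluing one map along a periodic family is
equivariant. -/
theorem chart_add (a b c y : ℝ) : chart (a + c) (b + c) y = chart a b y + c := by
  simp only [chart]
  ring

theorem chart_strictMono {a b : ℝ} (hab : a < b) : StrictMono (chart a b) := by
  intro x y hxy
  have h : (orderIsoIooNegOneOne ℝ x : ℝ) < orderIsoIooNegOneOne ℝ y := by
    exact_mod_cast (orderIsoIooNegOneOne ℝ).strictMono hxy
  have := mul_lt_mul_of_pos_left h (sub_pos.2 hab)
  simp only [chart]
  linarith

theorem chart_mem {a b : ℝ} (hab : a < b) (y : ℝ) : chart a b y ∈ Ioo a b := by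
  obtain ⟨h1, h2⟩ := (orderIsoIooNegOneOne ℝ y).2
  have h3 := mul_lt_mul_of_pos_left h1 (sub_pos.2 hab)
  have h4 := mul_lt_mul_of_pos_left h2 (sub_pos.2 hab)
  simp only [chart, mem_Ioo]
  constructor <;> linarith

theorem exists_chart_eq {a b x : ℝ} (hx : x ∈ Ioo a b) : ∃ y, chart a b y = x := by
  have hab : 0 < b - a := sub_pos.2 (hx.1.trans hx.2)
  refine ⟨(orderIsoIooNegOneOne ℝ).symm ⟨2 * ((x - a) / (b - a)) - 1, ?_, ?_⟩, ?_⟩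
  · have : 0 < (x - a) / (b - a) := div_pos (sub_pos.2 hx.1) hab
    linarith
  · have : (x - a) / (b - a) < 1 := (div_lt_one hab).2 (by linarith [hx.2])
    linarith
  · simp only [chart, OrderIso.apply_symm_apply]
    field_simp
    ring

/-- An increasing homeomorphism fixing `a` and `b` restricts to `(a, b)`, read in the chart. -/
theorem exists_chart_conj {a b : ℝ} (hab : a < b) (g : ℝ ≃o ℝ) (ha : g a = a) (hb : g b = b) :
    ∃ h : ℝ ≃o ℝ, ∀ y, chart a b (h y) = g (chart a b y) := by
  have hmem : ∀ y, g (chart a b y) ∈ Ioo a b := fun y => by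
    have := chart_mem hab y
    exact ⟨by simpa [ha] using g.strictMono this.1, by simpa [hb] using g.strictMono this.2⟩
  choose f hf using fun y => exists_chart_eq (hmem y)
  have hmono : StrictMono f := fun x y hxy => by
    rw [← (chart_strictMono hab).lt_iff_lt, hf, hf]
    exact g.strictMono (chart_strictMono hab hxy)
  have hsurj : Function.Surjective f := fun z => by
    have hz := chart_mem hab z
    obtain ⟨y, hy⟩ := exists_chart_eq (x := g.symm (chart a b z)) (a := a) (b := b)
      ⟨by rw [g.lt_symm_apply, ha]; exact hz.1, by rw [g.symm_apply_lt, hb]; exact hz.2⟩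
    exact ⟨y, (chart_strictMono hab).injective (by rw [hf, hy, g.apply_symm_apply])⟩
  exact ⟨hmono.orderIsoOfSurjective f hsurj, hf⟩

/-- A family of nonempty, pairwise disjoint open intervals. -/
structure DisjointIntervals {ι : Type*} (a b : ι → ℝ) : Prop where
  lt : ∀ i, a i < b i
  sep : Pairwise fun i j => b i ≤ a j ∨ b j ≤ a i

namespace DisjointIntervals

variable {ι : Type*} {a b : ι → ℝ}

theorem eq_of_mem (hd : DisjointIntervals a b) {i j : ι} {x : ℝ}
    (hi : x ∈ Ioo (a i) (b i)) (hj : x ∈ Ioo (a j) (b j)) :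
    i = j := by
  by_contra hne
  rcases hd.sep hne with h | h
  · exact absurd (hi.2.trans_le h) hj.1.not_gt
  · exact absurd (hj.2.trans_le h) hi.1.not_gt

/-- Endpoints avoid all the intervals, so a map supported in their union fixes them and preserves
each interval. -/
theorem left_notMem (hd : DisjointIntervals a b) (i j : ι) : a i ∉ Ioo (a j) (b j) := by
  rintro ⟨h1, h2⟩
  rcases eq_or_ne i j with rfl | hne
  · exact h1.false
  · have := hd.lt i
    rcases hd.sep hne with h | h <;> linarith

theorem right_notMem (hd : DisjointIntervals a b) (i j : ι) : b i ∉ Ioo (a j) (b j) := by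
  rintro ⟨h1, h2⟩
  rcases eq_or_ne i j with rfl | hne
  · exact h2.false
  · have := hd.lt i
    rcases hd.sep hne with h | h <;> linarith

open Classical in
/-- The map acting on the `i`-th interval as `h i`, read in the chart, and trivially elsewhere. -/
noncomputable def glueFun (a b : ι → ℝ) (h : ι → ℝ ≃o ℝ) (x : ℝ) : ℝ :=
  if hx : ∃ p : ι × ℝ, a p.1 < b p.1 ∧ chart (a p.1) (b p.1) p.2 = x then
    chart (a hx.choose.1) (b hx.choose.1) (h hx.choose.1 hx.choose.2)
  else x

theorem glueFun_chart (hd : DisjointIntervals a b) (h : ι → ℝ ≃o ℝ) (i : ι) (y : ℝ) :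
    glueFun a b h (chart (a i) (b i) y) = chart (a i) (b i) (h i y) := by
  have hx : ∃ p : ι × ℝ, a p.1 < b p.1 ∧
      chart (a p.1) (b p.1) p.2 = chart (a i) (b i) y := ⟨(i, y), hd.lt i, rfl⟩
  rw [glueFun, dif_pos hx]
  have h3 := hx.choose_spec.2
  generalize hx.choose = p at h3 ⊢
  obtain ⟨j, z⟩ := p
  obtain rfl : i = j := hd.eq_of_mem (chart_mem (hd.lt i) y) (h3 ▸ chart_mem (hd.lt j) z)
  simp only at h3 ⊢
  rw [(chart_strictMono (hd.lt i)).injective h3]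

theorem glueFun_of_notMem (h : ι → ℝ ≃o ℝ) {x : ℝ} (hx : ∀ i, x ∉ Ioo (a i) (b i)) :
    glueFun a b h x = x := by
  rw [glueFun, dif_neg]
  rintro ⟨p, hp, rfl⟩
  exact hx p.1 (chart_mem hp p.2)

theorem exists_chart_eq_or_notMem (a b : ι → ℝ) (x : ℝ) :
    (∃ i y, x = chart (a i) (b i) y) ∨ ∀ i, x ∉ Ioo (a i) (b i) := by
  by_cases h : ∃ i, x ∈ Ioo (a i) (b i)
  · obtain ⟨i, hi⟩ := h
    obtain ⟨y, rfl⟩ := exists_chart_eq hi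
    exact Or.inl ⟨i, y, rfl⟩
  · exact Or.inr (not_exists.1 h)

theorem glueFun_glueFun (hd : DisjointIntervals a b) (h h' : ι → ℝ ≃o ℝ) (x : ℝ) :
    glueFun a b h (glueFun a b h' x) = glueFun a b (h * h') x := by
  obtain ⟨i, y, rfl⟩ | hx := exists_chart_eq_or_notMem a b x
  · simp [hd.glueFun_chart]
  · simp [glueFun_of_notMem _ hx]

theorem glueFun_one (hd : DisjointIntervals a b) (x : ℝ) : glueFun a b 1 x = x := by
  obtain ⟨i, y, rfl⟩ | hx := exists_chart_eq_or_notMem a b x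
  · simp [hd.glueFun_chart]
  · simp [glueFun_of_notMem _ hx]

theorem glueFun_strictMono (hd : DisjointIntervals a b) (h : ι → ℝ ≃o ℝ) :
    StrictMono (glueFun a b h) := by
  intro x x' hxx
  obtain ⟨i, y, rfl⟩ | hx := exists_chart_eq_or_notMem a b x <;>
    obtain ⟨j, z, rfl⟩ | hz := exists_chart_eq_or_notMem a b x'
  · rw [hd.glueFun_chart, hd.glueFun_chart]
    have h1 := chart_mem (hd.lt i) y
    have h2 := chart_mem (hd.lt j) z
    have h3 := chart_mem (hd.lt i) (h i y)
    have h4 := chart_mem (hd.lt j) (h j z)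
    rcases eq_or_ne i j with rfl | hne
    · exact chart_strictMono (hd.lt i)
        ((h i).strictMono ((chart_strictMono (hd.lt i)).lt_iff_lt.1 hxx))
    · rcases hd.sep hne with h | h
      · linarith [h3.2, h4.1]
      · linarith [h1.1, h2.2]
  · rw [hd.glueFun_chart, glueFun_of_notMem _ hz]
    have h1 := chart_mem (hd.lt i) y
    have h3 := chart_mem (hd.lt i) (h i y)
    exact h3.2.trans_le (not_lt.1 fun hlt => hz i ⟨h1.1.trans hxx, hlt⟩)
  · rw [hd.glueFun_chart, glueFun_of_notMem _ hx]
    have h1 := chart_mem (hd.lt j) z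
    have h3 := chart_mem (hd.lt j) (h j z)
    exact (not_lt.1 fun hlt => hx j ⟨hlt, hxx.trans h1.2⟩).trans_lt h3.1
  · rwa [glueFun_of_notMem _ hx, glueFun_of_notMem _ hz]

/-- The action of a power of `ℝ ≃o ℝ` on the line through a family of disjoint intervals. -/
noncomputable def glue (hd : DisjointIntervals a b) : (ι → ℝ ≃o ℝ) →* (ℝ ≃o ℝ) where
  toFun h := (hd.glueFun_strictMono h).orderIsoOfRightInverse _ (glueFun a b h⁻¹) fun x => by
    rw [hd.glueFun_glueFun, mul_inv_cancel, hd.glueFun_one]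
  map_one' := RelIso.ext hd.glueFun_one
  map_mul' h h' := RelIso.ext fun x => (hd.glueFun_glueFun h h' x).symm

theorem glue_chart (hd : DisjointIntervals a b) (h : ι → ℝ ≃o ℝ) (i : ι) (y : ℝ) :
    hd.glue h (chart (a i) (b i) y) = chart (a i) (b i) (h i y) :=
  hd.glueFun_chart h i y

theorem glue_of_notMem (hd : DisjointIntervals a b) (h : ι → ℝ ≃o ℝ) {x : ℝ}
    (hx : ∀ i, x ∉ Ioo (a i) (b i)) :
    hd.glue h x = x :=
  glueFun_of_notMem h hx

theorem eq_glue (hd : DisjointIntervals a b) {g : ℝ ≃o ℝ}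
    (hg : ∀ x, (∀ i, x ∉ Ioo (a i) (b i)) → g x = x)
    {h : ι → ℝ ≃o ℝ} (hh : ∀ i y, chart (a i) (b i) (h i y) = g (chart (a i) (b i) y)) :
    hd.glue h = g := by
  ext x
  obtain ⟨i, y, rfl⟩ | hx := exists_chart_eq_or_notMem a b x
  · rw [glue_chart, hh]
  · rw [glue_of_notMem hd h hx, hg x hx]

/-- The image of `glue` consists of the maps supported in the union of the intervals. -/
theorem exists_glue_eq (hd : DisjointIntervals a b) {g : ℝ ≃o ℝ}
    (hg : ∀ x, (∀ i, x ∉ Ioo (a i) (b i)) → g x = x) :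
    ∃ h, hd.glue h = g := by
  choose h hh using fun i => exists_chart_conj (hd.lt i) g (hg _ (hd.left_notMem i))
    (hg _ (hd.right_notMem i))
  exact ⟨h, hd.eq_glue hg hh⟩

end DisjointIntervals

end

/-! ### Translations and conjugacy -/

section

open Set

/-- Translation by `r` as an element of `ℝ ≃o ℝ`. -/
noncomputable def translation (r : ℝ) : ℝ ≃o ℝ := OrderIso.addRight r

@[simp]
theorem translation_apply (r x : ℝ) : translation r x = x + r := rfl

@[simp]
theorem translation_inv_apply (r x : ℝ) : (translation r)⁻¹ x = x - r := by
  rw [← (translation r).injective.eq_iff, RelIso.apply_inv_self]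
  simp

theorem translation_inv_mul (r s : ℝ) : (translation r)⁻¹ * translation s =
    translation (s - r) := by
  ext x
  simp
  ring

theorem translation_pow (r : ℝ) (n : ℕ) : translation r ^ n = translation (n * r) := by
  induction n with
  | zero => ext x; simp
  | succ n ih => rw [pow_succ, ih]; ext x; simp; ring

theorem translation_zpow (r : ℝ) (n : ℤ) : translation r ^ n = translation (n * r) := by
  cases n with
  | ofNat n => simpa using translation_pow r n
  | negSucc n =>
    rw [zpow_negSucc, translation_pow]
    ext x
    simp
    ring

namespace OrderIso

theorem zpow_strictMono {f : ℝ ≃o ℝ} (hf : ∀ x, x < f x) (x : ℝ) :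
    StrictMono fun n : ℤ => (f ^ n) x :=
  strictMono_int_of_lt_succ fun n => by
    rw [zpow_add_one, (Commute.self_zpow f n).eq.symm]
    exact hf _

/-- A bounded increasing orbit would converge to a fixed point. -/
theorem exists_lt_zpow {f : ℝ ≃o ℝ} (hf : ∀ x, x < f x) (y : ℝ) : ∃ n : ℕ, y < (f ^ n) 0 := by
  by_contra! h
  have hmono : Monotone fun n : ℕ => (f ^ n) 0 := monotone_nat_of_le_succ fun n => by
    rw [pow_succ']
    exact (hf _).le
  have hlim := tendsto_atTop_ciSup hmono ⟨y, by rintro _ ⟨n, rfl⟩; exact h n⟩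
  have hlim' := (f.continuous.tendsto _).comp hlim
  have hlim'' := (Filter.tendsto_add_atTop_iff_nat 1).2 hlim
  refine (hf _).ne (tendsto_nhds_unique hlim'' ?_)
  refine hlim'.congr fun n => ?_
  rw [pow_succ']
  rfl

theorem exists_zpow_lt {f : ℝ ≃o ℝ} (hf : ∀ x, x < f x) (y : ℝ) :
    ∃ n : ℕ, (f ^ (-n : ℤ)) 0 < y := by
  by_contra! h
  have hanti : Antitone fun n : ℕ => (f ^ (-n : ℤ)) 0 := fun m n hmn =>
    (zpow_strictMono hf 0).monotone (by simpa using hmn)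
  have hlim := tendsto_atTop_ciInf hanti ⟨y, by rintro _ ⟨n, rfl⟩; exact h n⟩
  have hlim'' := (Filter.tendsto_add_atTop_iff_nat 1).2 hlim
  have hlim' := (f.continuous.tendsto _).comp hlim''
  refine (hf _).ne (tendsto_nhds_unique hlim (hlim'.congr fun n => ?_))
  rw [Function.comp_apply, ← RelIso.mul_apply, ← zpow_one_add]
  congr 2
  push_cast
  ring

/-- The `f`-orbit of `0` cuts the line into fundamental domains of `f`. -/
theorem exists_zpow_mem_Ico {f : ℝ ≃o ℝ} (hf : ∀ x, x < f x) (y : ℝ) :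
    ∃ n : ℤ, (f ^ n) y ∈ Ico 0 (f 0) := by
  obtain ⟨N, hN⟩ := exists_lt_zpow hf y
  obtain ⟨M, hM⟩ := exists_zpow_lt hf y
  obtain ⟨n, hn, hmax⟩ := Int.exists_greatest_of_bdd (P := fun n : ℤ => (f ^ n) 0 ≤ y)
    ⟨N, fun n hn => (zpow_strictMono hf 0).le_iff_le.1 (hn.trans (by simpa using hN.le))⟩
    ⟨_, hM.le⟩
  have hlt : y < (f ^ (n + 1)) 0 := by
    by_contra! h
    have := hmax _ h
    omega
  refine ⟨-n, ?_, ?_⟩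
  · rw [← (f ^ n).le_iff_le, ← RelIso.mul_apply]
    simpa using hn
  · rw [← (f ^ n).lt_iff_lt, ← RelIso.mul_apply, ← RelIso.mul_apply, ← zpow_add_one]
    simpa using hlt

/-- A homeomorphism moving every point to the right is conjugate to the translation by `1`. -/
theorem exists_conj_translation {f : ℝ ≃o ℝ} (hf : ∀ x, x < f x) :
    ∃ φ : ℝ ≃o ℝ, f = φ * translation 1 * φ⁻¹ := by
  have h0 : 0 < f 0 := hf 0
  -- Linear from [0, 1) onto the fundamental domain [0, f 0), extended equivariantly.
  let φ : ℝ → ℝ := fun s => (f ^ ⌊s⌋) (Int.fract s * f 0)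
  have hstep : ∀ s, φ (s + 1) = f (φ s) := fun s => by
    simp only [φ, Int.floor_add_one, Int.fract_add_one]
    rw [← RelIso.mul_apply, (Commute.self_zpow f _).eq, zpow_add_one]
  have hmono : StrictMono φ := by
    intro s t hst
    rcases (Int.floor_mono hst.le).eq_or_lt with h | h
    · simp only [φ, h, OrderIso.lt_iff_lt]
      refine mul_lt_mul_of_pos_right ?_ h0
      rw [Int.fract, Int.fract, h]
      linarith
    · calc φ s < (f ^ ⌊s⌋) (f 0) := by
            simpa only [φ, OrderIso.lt_iff_lt] using
              mul_lt_of_lt_one_left h0 (Int.fract_lt_one s)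
        _ = (f ^ (⌊s⌋ + 1)) 0 := by rw [zpow_add_one]; rfl
        _ ≤ (f ^ ⌊t⌋) 0 := (zpow_strictMono hf 0).monotone h
        _ ≤ φ t := by
            simpa only [φ, OrderIso.le_iff_le] using mul_nonneg (Int.fract_nonneg t) h0.le
  have hsurj : Function.Surjective φ := by
    intro y
    obtain ⟨n, hn0, hn1⟩ := exists_zpow_mem_Ico hf y
    have hmem : (f ^ n) y / f 0 ∈ Ico (0 : ℝ) 1 :=
      ⟨div_nonneg hn0 h0.le, (div_lt_one h0).2 hn1⟩
    refine ⟨(f ^ n) y / f 0 + (-n : ℤ), ?_⟩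
    simp only [φ, Int.floor_add_intCast, Int.fract_add_intCast, Int.fract_eq_self.2 hmem,
      Int.floor_eq_zero_iff.2 hmem]
    rw [div_mul_cancel₀ _ h0.ne', ← RelIso.mul_apply, ← zpow_add]
    simp
  refine ⟨hmono.orderIsoOfSurjective φ hsurj, ?_⟩
  rw [eq_mul_inv_iff_mul_eq]
  ext s
  exact (hstep s).symm

/-- Any `g` can be followed back and forth: some `t` and `g * t` both move every point right. -/
theorem exists_lt_and_lt_mul (g : ℝ ≃o ℝ) :
    ∃ t : ℝ ≃o ℝ, (∀ x, x < t x) ∧ ∀ x, x < (g * t) x := by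
  have hmono : StrictMono fun x => max x (g⁻¹ x) + 1 := fun x y hxy =>
    add_lt_add_left (max_lt_max hxy (g⁻¹.strictMono hxy)) 1
  have hsurj : Function.Surjective fun x => max x (g⁻¹ x) + 1 := by
    intro y
    -- The preimage of `y` is the minimum of `y - 1` and `g (y - 1)`.
    rcases le_total (y - 1) (g (y - 1)) with h | h
    · refine ⟨y - 1, ?_⟩
      have : g⁻¹ (y - 1) ≤ y - 1 := by
        rw [← g.le_iff_le, RelIso.apply_inv_self]; exact h
      simp [max_eq_left this]
    · refine ⟨g (y - 1), ?_⟩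
      simp [max_eq_right h]
  refine ⟨hmono.orderIsoOfSurjective _ hsurj, fun x => ?_, fun x => ?_⟩
  · exact (le_max_left x (g⁻¹ x)).trans_lt (lt_add_one _)
  · rw [RelIso.mul_apply, ← g⁻¹.lt_iff_lt, RelIso.inv_apply_self]
    exact (le_max_right x (g⁻¹ x)).trans_lt (lt_add_one _)

theorem eq_top_of_forall_lt_mem {H : Subgroup (ℝ ≃o ℝ)}
    (hH : ∀ f : ℝ ≃o ℝ, (∀ x, x < f x) → f ∈ H) : H = ⊤ := by
  refine (Subgroup.eq_top_iff' H).2 fun g => ?_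
  obtain ⟨t, ht, hgt⟩ := exists_lt_and_lt_mul g
  simpa using H.mul_mem (hH _ hgt) (H.inv_mem (hH t ht))

/-- A power of `ℝ ≃o ℝ` has no proper normal subgroup of small index. -/
theorem pi_eq_top_of_normal {ι : Type} {N : Subgroup (ι → ℝ ≃o ℝ)} (hN : N.Normal)
    (hs : N.SmallIndex) : N = ⊤ := by
  -- Pigeonhole on constant tuples of translations; conjugating coordinatewise then yields every
  -- tuple of maps moving all points right.
  obtain ⟨r, hr, hrN⟩ : ∃ r : ℝ, 0 < r ∧ (fun _ : ι => translation r) ∈ N := by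
    obtain ⟨r, s, hne, h⟩ := hs.exists_ne_inv_mul_mem (α := ℝ) Cardinal.mk_real.ge
      fun r => fun _ : ι => translation r
    have h' : (fun _ : ι => translation (s - r)) ∈ N := by
      convert h using 1
      ext1 i
      simp [translation_inv_mul]
    rcases lt_or_gt_of_ne hne with hlt | hlt
    · exact ⟨s - r, sub_pos.2 hlt, h'⟩
    · refine ⟨r - s, sub_pos.2 hlt, ?_⟩
      convert N.inv_mem h' using 1
      ext i x
      simp
      ring
  have hright : ∀ f : ι → ℝ ≃o ℝ, (∀ i x, x < f i x) → f ∈ N := by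
    intro f hf
    obtain ⟨ψ, hψ⟩ := exists_conj_translation (f := translation r) (by simpa using hr)
    choose φ hφ using fun i => exists_conj_translation (hf i)
    convert hN.conj_mem _ hrN fun i => φ i * ψ⁻¹ using 1
    ext1 i
    simp only [Pi.mul_apply, Pi.inv_apply]
    conv_lhs => rw [hφ i]
    rw [hψ]
    group
  refine (Subgroup.eq_top_iff' N).2 fun g => ?_
  choose t ht hgt using fun i => exists_lt_and_lt_mul (g i)
  simpa using N.mul_mem (hright (g * t) hgt) (N.inv_mem (hright t ht))

end OrderIso

end

/-! ### Small index subgroups on the line -/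

section

open Set

/-- `H` contains every increasing homeomorphism of the line supported in `S`. -/
def Subgroup.ContainsSupported (H : Subgroup (ℝ ≃o ℝ)) (S : Set ℝ) : Prop :=
  ∀ g : ℝ ≃o ℝ, (∀ x, x ∉ S → g x = x) → g ∈ H

theorem disjointIntervals_translates {p d : ℝ} (hd : 0 < d) {c : ℝ} (hc : d ≤ c) :
    DisjointIntervals (fun i : ℤ => p + i * c) (fun i : ℤ => p + d + i * c) where
  lt i := by linarith
  sep i j hij := by
    have key : ∀ i j : ℤ, i < j → p + d + i * c ≤ p + j * c := fun i j h => by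
      have h' : (i : ℝ) + 1 ≤ j := by exact_mod_cast h
      nlinarith
    rcases lt_or_gt_of_ne hij with h | h
    · exact Or.inl (key i j h)
    · exact Or.inr (key j i h)

/-- Infinitely many disjoint families, each invariant under integer translation: the first index
picks the family, the second the translate. -/
theorem disjointIntervals_harmonic :
    DisjointIntervals (fun i : ℕ × ℤ => 1 / ((i.1 : ℝ) + 2) + i.2)
      (fun i : ℕ × ℤ => 1 / ((i.1 : ℝ) + 1) + i.2) where
  lt i := by
    have : 1 / ((i.1 : ℝ) + 2) < 1 / ((i.1 : ℝ) + 1) :=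
      one_div_lt_one_div_of_lt (by positivity) (by linarith)
    linarith
  sep := by
    have h1 : ∀ n : ℕ, 1 / ((n : ℝ) + 1) ≤ 1 := fun n =>
      div_le_one_of_le₀ (by linarith [n.cast_nonneg (α := ℝ)]) (by positivity)
    have h0 : ∀ n : ℕ, 0 < 1 / ((n : ℝ) + 2) := fun n => by positivity
    have h2 : ∀ m n : ℕ, m < n → 1 / ((n : ℝ) + 1) ≤ 1 / ((m : ℝ) + 2) := fun m n h => by
      have h' : (m : ℝ) + 1 ≤ n := by exact_mod_cast h
      exact one_div_le_one_div_of_le (by positivity) (by linarith)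
    have h3 : ∀ k l : ℤ, k < l → (k : ℝ) + 1 ≤ l := fun k l h => by exact_mod_cast h
    rintro ⟨m, k⟩ ⟨n, l⟩ hne
    dsimp only
    rcases lt_trichotomy k l with h | rfl | h
    · exact Or.inl (by linarith [h1 m, h0 n, h3 k l h])
    · rcases lt_trichotomy m n with h | rfl | h
      · exact Or.inr (by linarith [h2 m n h])
      · exact absurd rfl hne
      · exact Or.inl (by linarith [h2 n m h])
    · exact Or.inr (by linarith [h1 n, h0 m, h3 l k h])

namespace Subgroup.SmallIndex

variable {H : Subgroup (ℝ ≃o ℝ)}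

theorem exists_containsSupported_translates (hH : H.SmallIndex) :
    ∃ a b : ℝ, a < b ∧ H.ContainsSupported (⋃ k : ℤ, Ioo (a + k) (b + k)) := by
  have hd := disjointIntervals_harmonic
  let uncur : (ℕ → ℤ → ℝ ≃o ℝ) →* (ℕ × ℤ → ℝ ≃o ℝ) :=
    { toFun := fun h i => h i.1 i.2, map_one' := rfl, map_mul' := fun _ _ => rfl }
  obtain ⟨n, hn⟩ := (hH.comap (hd.glue.comp uncur)).exists_mulSingle_mem
    fun N hN hs => OrderIso.pi_eq_top_of_normal hN hs
  refine ⟨1 / ((n : ℝ) + 2), 1 / ((n : ℝ) + 1), by simpa using hd.lt (n, 0), fun g hg => ?_⟩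
  have hg' : ∀ x, (∀ k : ℤ, x ∉ Ioo (1 / ((n : ℝ) + 2) + k) (1 / ((n : ℝ) + 1) + k)) →
      g x = x := fun x hx => hg x (by simpa using hx)
  have hg'' : ∀ x, (∀ i : ℕ × ℤ, x ∉ Ioo (1 / ((i.1 : ℝ) + 2) + i.2)
      (1 / ((i.1 : ℝ) + 1) + i.2)) → g x = x := fun x hx => hg' x fun k => hx (n, k)
  obtain ⟨h, rfl⟩ := hd.exists_glue_eq hg''
  -- Only row `n` is kept; the other rows are trivial because `g` is supported in the `n`-th family.
  have hmem := hn fun k => h (n, k)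
  rw [mem_comap] at hmem
  convert hmem using 1
  symm
  refine hd.eq_glue hg'' ?_
  rintro ⟨m, k⟩ y
  rcases eq_or_ne m n with rfl | hne
  · rw [hd.glue_chart]
    simp [uncur]
  · rw [hg']
    · simp [uncur, hne]
    · intro l hl
      exact hne (congrArg Prod.fst (hd.eq_of_mem (i := (m, k)) (j := (n, l))
        (chart_mem (hd.lt (m, k)) y) hl))

theorem exists_translation_mem (hH : H.SmallIndex) {ε : ℝ} (hε : 0 < ε) :
    ∃ r, 0 < r ∧ r < ε ∧ translation r ∈ H := by
  obtain ⟨⟨r, hr⟩, ⟨s, hs⟩, hne, h⟩ := hH.exists_ne_inv_mul_mem (α := Ioo 0 ε)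
    (Cardinal.mk_Ioo_real hε).ge fun r => translation r
  simp only [translation_inv_mul] at h
  rcases lt_or_gt_of_ne (fun h => hne (Subtype.ext h) : r ≠ s) with hlt | hlt
  · exact ⟨s - r, sub_pos.2 hlt, by linarith [hr.1, hs.2], h⟩
  · refine ⟨r - s, sub_pos.2 hlt, by linarith [hr.2, hs.1], ?_⟩
    convert H.inv_mem h using 1
    ext x
    simp
    ring

theorem exists_forall_containsSupported_translates (hH : H.SmallIndex) :
    ∃ (N : ℕ) (δ : ℝ), 0 < δ ∧ N * δ = 1 ∧
      ∀ x, H.ContainsSupported (⋃ k : ℤ, Ioo (x + k) (x + δ + k)) := by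
  obtain ⟨a, b, hab, hU⟩ := hH.exists_containsSupported_translates
  have hε : 0 < (b - a) / 2 := by linarith
  obtain ⟨r, hr0, hr, hrH⟩ := hH.exists_translation_mem hε
  obtain ⟨n, hn⟩ := exists_nat_one_div_lt hε
  refine ⟨n + 1, 1 / ((n : ℝ) + 1), by positivity, ?_, fun x g hg => ?_⟩
  · push_cast
    field_simp
  -- As both `r` and δ are below (b - a)/2, the interval (x, x + δ) lies in the translate of (a, b)
  -- by `j * r`.
  · set j : ℤ := ⌊(x - a) / r⌋
    have hj1 : j * r ≤ x - a := (le_div_iff₀ hr0).1 (Int.floor_le _)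
    have hj2 : x - a < (j + 1) * r := (div_lt_iff₀ hr0).1 (Int.lt_floor_add_one _)
    have ht : translation (j * r) ∈ H := translation_zpow r j ▸ H.zpow_mem hrH j
    have hconj : (translation (j * r))⁻¹ * g * translation (j * r) ∈ H := by
      refine hU _ fun y hy => ?_
      have : g (y + j * r) = y + j * r := by
        refine hg _ fun hmem => hy ?_
        obtain ⟨k, hk1, hk2⟩ := mem_iUnion.1 hmem
        exact mem_iUnion.2 ⟨k, by linarith, by linarith⟩
      simp [this]
    simpa [mul_assoc] using H.mul_mem (H.mul_mem ht hconj) (H.inv_mem ht)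

theorem exists_forall_containsSupported_compl (hH : H.SmallIndex) :
    ∃ (N : ℕ) (δ : ℝ), 0 < δ ∧ N * δ = 1 ∧
      ∀ p, H.ContainsSupported {x | ∀ i : ℤ, x ≠ p + i * δ} := by
  obtain ⟨N, δ, hδ, hN, hx⟩ := hH.exists_forall_containsSupported_translates
  have hN0 : (N : ℤ) ≠ 0 := by
    rintro h
    have : (N : ℝ) = 0 := by exact_mod_cast h
    simp [this] at hN
  refine ⟨N, δ, hδ, hN, fun p g hg => ?_⟩
  have hd := disjointIntervals_translates (p := p) hδ le_rfl
  obtain ⟨h, rfl⟩ := hd.exists_glue_eq (g := g) fun x hx => hg x fun hx' => by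
    have h1 : ⌊(x - p) / δ⌋ * δ ≤ x - p := (le_div_iff₀ hδ).1 (Int.floor_le _)
    have h2 : x - p < (⌊(x - p) / δ⌋ + 1) * δ := (div_lt_iff₀ hδ).1 (Int.lt_floor_add_one _)
    have h3 := hx' ⌊(x - p) / δ⌋
    refine hx ⌊(x - p) / δ⌋ ⟨lt_of_le_of_ne (by linarith) h3.symm, by linarith⟩
  -- Induction on the number of residue classes mod `N` on which `h` may act. Since N δ = 1, the
  -- intervals of one class are the integer translates of a single one.
  have key : ∀ (k : ℕ) (h : ℤ → ℝ ≃o ℝ), (∀ i : ℤ, (k : ℤ) ≤ i % N → h i = 1) →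
      hd.glue h ∈ H := by
    intro k
    induction k with
    | zero =>
      intro h hh
      have : h = 1 := funext fun i => hh i (by simpa using Int.emod_nonneg i hN0)
      simp [this]
    | succ k ih =>
      intro h hh
      have hsplit : h = (fun i : ℤ => if i % N = k then h i else 1) *
          fun i : ℤ => if i % N = k then 1 else h i := by
        ext1 i
        by_cases hi : i % N = k <;> simp [hi]
      rw [hsplit, map_mul]
      refine H.mul_mem (hx (p + k * δ) _ fun x hx => ?_) (ih _ fun i hi => ?_)
      · obtain ⟨i, y, rfl⟩ | hx' :=
          DisjointIntervals.exists_chart_eq_or_notMem (fun i : ℤ => p + i * δ)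
          (fun i : ℤ => p + δ + i * δ) x
        · rw [hd.glue_chart, if_neg, RelIso.one_apply]
          intro hi
          obtain ⟨h1, h2⟩ := chart_mem (hd.lt i) y
          have hi' : (i : ℝ) * δ = k * δ + (i / N : ℤ) := by
            have : (i : ℝ) = k + N * (i / N : ℤ) := by
              exact_mod_cast hi ▸ (Int.emod_add_mul_ediv i N).symm
            rw [this]
            linear_combination ((i / N : ℤ) : ℝ) * hN
          exact hx (mem_iUnion.2 ⟨i / N, by linarith, by linarith⟩)
        · exact hd.glue_of_notMem _ hx'
      · split_ifs with hik
        · rfl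
        · exact hh i (by push_cast; omega)
  exact key N h fun i hi => absurd hi (not_le.2 (Int.emod_lt_of_pos i (by omega)))

theorem translation_one_mem (hH : H.SmallIndex) : translation 1 ∈ H := by
  obtain ⟨N, δ, hδ, hN, hp⟩ := hH.exists_forall_containsSupported_compl
  have hd := disjointIntervals_translates (p := -(δ / 2)) hδ le_rfl
  obtain ⟨y₀, hy₀⟩ : ∃ y, chart (-(δ / 2)) (-(δ / 2) + δ) y = 0 :=
    exists_chart_eq ⟨by linarith, by linarith⟩
  obtain ⟨y₁, hy₁⟩ : ∃ y, chart (-(δ / 2)) (-(δ / 2) + δ) y = δ / 4 :=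
    exists_chart_eq ⟨by linarith, by linarith⟩
  -- `u` fixes the grid of midpoints and agrees with translation by δ/4 on the grid δℤ, so the
  -- quotient of the two fixes δℤ.
  set u := hd.glue fun _ => translation (y₁ - y₀)
  have hu : u ∈ H := hp (-(δ / 2)) _ fun x hx => by
    simp only [mem_ofPred_eq, not_forall, not_not] at hx
    obtain ⟨i, rfl⟩ := hx
    exact hd.glue_of_notMem _ (hd.left_notMem i)
  have hu' : ∀ i : ℤ, u (0 + i * δ) = δ / 4 + i * δ := fun i => by
    rw [← hy₀, ← hy₁, ← chart_add, ← chart_add, hd.glue_chart]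
    simp
  have hv : u⁻¹ * translation (δ / 4) ∈ H := hp 0 _ fun x hx => by
    simp only [mem_ofPred_eq, not_forall, not_not] at hx
    obtain ⟨i, rfl⟩ := hx
    rw [RelIso.mul_apply, translation_apply, ← u.injective.eq_iff, RelIso.apply_inv_self, hu']
    ring
  have ht : translation (δ / 4) ∈ H := by simpa using H.mul_mem hu hv
  have := H.pow_mem ht (4 * N)
  rw [translation_pow] at this
  convert this using 2
  push_cast
  linear_combination -hN

/-- The group of increasing homeomorphisms of the line has no proper subgroup of small index. -/
theorem eq_top (hH : H.SmallIndex) : H = ⊤ := by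
  refine OrderIso.eq_top_of_forall_lt_mem fun f hf => ?_
  obtain ⟨φ, rfl⟩ := OrderIso.exists_conj_translation hf
  -- A conjugate of `H` also has small index, hence contains `translation 1`.
  exact (hH.comap (MulAut.conj φ).toMonoidHom).translation_one_mem

/-- Subgroups of small index contain the images of all actions of `ℝ ≃o ℝ`. -/
theorem map_mem {G : Type} [Group G] {K : Subgroup G} (hK : K.SmallIndex)
    (φ : (ℝ ≃o ℝ) →* G) (g : ℝ ≃o ℝ) : φ g ∈ K := by
  have : g ∈ K.comap φ := (hK.comap φ).eq_top ▸ Subgroup.mem_top g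
  exact this

end Subgroup.SmallIndex

end

/-! ### The circle, through periodic lifts -/

section

open Set Real

/-- The increasing homeomorphisms of the line commuting with the translation by `2π`. -/
noncomputable def periodicReal : Subgroup (ℝ ≃o ℝ) :=
  Subgroup.centralizer {translation (2 * π)}

theorem mem_periodicReal {F : ℝ ≃o ℝ} :
    F ∈ periodicReal ↔ ∀ x, F (x + 2 * π) = F x + 2 * π := by
  rw [periodicReal, Subgroup.mem_centralizer_singleton_iff, RelIso.ext_iff]
  rfl

theorem translation_mem_periodicReal (r : ℝ) : translation r ∈ periodicReal :=
  mem_periodicReal.2 fun x => by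
    simp
    ring

theorem apply_add_int_mul_of_mem_periodicReal {F : ℝ ≃o ℝ} (hF : F ∈ periodicReal) (x : ℝ)
    (k : ℤ) : F (x + k * (2 * π)) = F x + k * (2 * π) := by
  have h : Commute F (translation (2 * π)) := RelIso.ext (mem_periodicReal.1 hF)
  have h' := h.zpow_right k
  rw [translation_zpow] at h'
  exact RelIso.ext_iff.1 h' x

theorem exp_apply_arg_exp {F : ℝ ≃o ℝ} (hF : F ∈ periodicReal) (t : ℝ) :
    Circle.exp (F (Complex.arg (Circle.exp t))) = Circle.exp (F t) := by
  obtain ⟨m, hm⟩ := Circle.exp_eq_exp.1 (Circle.exp_arg (Circle.exp t))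
  rw [hm, apply_add_int_mul_of_mem_periodicReal hF]
  exact Circle.exp_eq_exp.2 ⟨m, rfl⟩

/-- The jump of `arg` is harmless: continuity is tested after composing with the quotient map
`Circle.exp`. -/
theorem continuous_exp_apply_arg {F : ℝ ≃o ℝ} (hF : F ∈ periodicReal) :
    Continuous fun z : Circle => Circle.exp (F (Complex.arg z)) := by
  rw [Circle.isAddQuotientCoveringMap_exp.toIsQuotientMap.continuous_iff]
  refine (Circle.exp.continuous.comp F.continuous).congr fun t => ?_
  exact (exp_apply_arg_exp hF t).symm

/-- The homeomorphism of the circle with a given lift. -/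
noncomputable def circleHom : periodicReal →* (Circle ≃ₜ Circle) where
  toFun F :=
    { toFun := fun z => Circle.exp (F.1 (Complex.arg z))
      invFun := fun z => Circle.exp ((F⁻¹).1 (Complex.arg z))
      left_inv := fun z => (exp_apply_arg_exp (F⁻¹).2 _).trans (by simp)
      right_inv := fun z => (exp_apply_arg_exp F.2 _).trans (by simp)
      continuous_toFun := continuous_exp_apply_arg F.2
      continuous_invFun := continuous_exp_apply_arg (F⁻¹).2 }
  map_one' := Homeomorph.ext fun z => by
    change Circle.exp (Complex.arg z) = z
    simp
  map_mul' F G := Homeomorph.ext fun z => (exp_apply_arg_exp F.2 (G.1 (Complex.arg z))).symm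

theorem circleHom_exp (F : periodicReal) (t : ℝ) :
    circleHom F (Circle.exp t) = Circle.exp (F.1 t) :=
  exp_apply_arg_exp F.2 t

theorem disjointIntervals_arcs (p : ℝ) : DisjointIntervals (fun i : ℤ => p + i * (2 * π))
    (fun i : ℤ => p + 2 * π + i * (2 * π)) :=
  disjointIntervals_translates two_pi_pos le_rfl

/-- The action of `ℝ ≃o ℝ` on the circle minus a point, lifted to the line. -/
noncomputable def arcHom (p : ℝ) : (ℝ ≃o ℝ) →* periodicReal :=
  ((disjointIntervals_arcs p).glue.comp (Pi.constMonoidHom ℤ (ℝ ≃o ℝ))).codRestrict periodicReal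
    fun h => mem_periodicReal.2 fun x => by
      have hd := disjointIntervals_arcs p
      have hshift : ∀ (i : ℤ) (y : ℝ), chart (p + i * (2 * π)) (p + 2 * π + i * (2 * π)) y + 2 * π =
          chart (p + (i + 1 : ℤ) * (2 * π)) (p + 2 * π + (i + 1 : ℤ) * (2 * π)) y := by
        intro i y
        rw [← chart_add]
        push_cast
        congr 1 <;> ring
      simp only [MonoidHom.comp_apply]
      obtain ⟨i, y, rfl⟩ | hx :=
          DisjointIntervals.exists_chart_eq_or_notMem (fun i : ℤ => p + i * (2 * π))
        (fun i : ℤ => p + 2 * π + i * (2 * π)) x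
      · rw [hshift, hd.glue_chart, hd.glue_chart, hshift]
        rfl
      · rw [hd.glue_of_notMem _ hx, hd.glue_of_notMem]
        rintro i ⟨h1, h2⟩
        refine hx (i - 1) ⟨?_, ?_⟩ <;> push_cast <;> linarith

theorem arcHom_apply_chart (p : ℝ) (h : ℝ ≃o ℝ) (y : ℝ) :
    (arcHom p h).1 (chart p (p + 2 * π) y) = chart p (p + 2 * π) (h y) := by
  change (disjointIntervals_arcs p).glue (fun _ => h) _ = _
  simpa using (disjointIntervals_arcs p).glue_chart (fun _ => h) 0 y

/-- A periodic map fixing `p` fixes all its translates by 2πℤ and acts by the same coordinate map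
between consecutive ones. -/
theorem exists_arcHom_eq {p : ℝ} (F : periodicReal) (hF : F.1 p = p) : ∃ h, arcHom p h = F := by
  have hpi := two_pi_pos
  obtain ⟨h, hh⟩ := exists_chart_conj (a := p) (b := p + 2 * π) (by linarith) F.1 hF
    (by rw [mem_periodicReal.1 F.2, hF])
  refine ⟨h, Subtype.ext ((disjointIntervals_arcs p).eq_glue (fun x hx => ?_) fun i y => ?_)⟩
  · have h1 : ⌊(x - p) / (2 * π)⌋ * (2 * π) ≤ x - p := (le_div_iff₀ hpi).1 (Int.floor_le _)
    have h2 : x - p < (⌊(x - p) / (2 * π)⌋ + 1) * (2 * π) :=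
      (div_lt_iff₀ hpi).1 (Int.lt_floor_add_one _)
    have h3 : x = p + ⌊(x - p) / (2 * π)⌋ * (2 * π) := by
      by_contra hne
      exact hx _ ⟨lt_of_le_of_ne (by linarith) (Ne.symm hne), by linarith⟩
    rw [h3, apply_add_int_mul_of_mem_periodicReal F.2, hF]
  · simp only [Pi.constMonoidHom_apply, Function.const_apply]
    rw [chart_add, chart_add, hh, apply_add_int_mul_of_mem_periodicReal F.2]

theorem circleHom_mem {H : Subgroup (Circle ≃ₜ Circle)} (hH : H.SmallIndex) (F : periodicReal) :
    circleHom F ∈ H := by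
  have hpi := two_pi_pos
  have hfix : ∀ (p : ℝ) (F : periodicReal), F.1 p = p → circleHom F ∈ H := fun p F hF => by
    obtain ⟨h, rfl⟩ := exists_arcHom_eq F hF
    exact hH.map_mem (circleHom.comp (arcHom p)) h
  set k : ℤ := ⌊F.1 0 / (2 * π)⌋
  have hk1 : k * (2 * π) ≤ F.1 0 := (le_div_iff₀ hpi).1 (Int.floor_le _)
  have hk2 : F.1 0 < (k + 1) * (2 * π) := (div_lt_iff₀ hpi).1 (Int.lt_floor_add_one _)
  -- Here 0 ≤ c < 2π, so the interval of length 2π centred at c/2 contains 0 and `c`. A map `u`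
  -- fixing its endpoints moves 0 to `c`; modulo a deck translation, `F` is `u` times a map fixing
  -- 0.
  set c := F.1 0 - k * (2 * π) with hc
  obtain ⟨y₀, hy₀⟩ : ∃ y, chart (c / 2 - π) (c / 2 - π + 2 * π) y = 0 :=
    exists_chart_eq ⟨by linarith, by linarith⟩
  obtain ⟨y₁, hy₁⟩ : ∃ y, chart (c / 2 - π) (c / 2 - π + 2 * π) y = c :=
    exists_chart_eq ⟨by linarith, by linarith⟩
  set u := arcHom (c / 2 - π) (translation (y₁ - y₀))
  have hu : u.1 0 = c := by
    rw [← hy₀, arcHom_apply_chart]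
    simp [hy₁]
  let t : periodicReal := ⟨translation (k * (2 * π)), translation_mem_periodicReal _⟩
  have ht : circleHom t = 1 := by
    ext1 z
    obtain ⟨s, rfl⟩ := Circle.exp_surjective z
    rw [circleHom_exp]
    exact Circle.exp_eq_exp.2 ⟨k, rfl⟩
  have hv := hfix 0 (u⁻¹ * (t⁻¹ * F)) (by
    change (u.1)⁻¹ ((translation (k * (2 * π)))⁻¹ (F.1 0)) = 0
    rw [translation_inv_apply, ← hc, ← hu, RelIso.inv_apply_self])
  have hu' : circleHom u ∈ H := hH.map_mem (circleHom.comp (arcHom _)) _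
  have := H.mul_mem hu' hv
  rw [← map_mul, mul_inv_cancel_left, map_mul, map_inv, ht] at this
  simpa using this

theorem exists_circleHom_eq {f : Circle ≃ₜ Circle} (hf : f ∈ homeoPlusCircle) :
    ∃ F, circleHom F = f := by
  obtain ⟨F, hF, hlift⟩ := hf
  have hpi := two_pi_pos
  let F' : ℝ ≃o ℝ := hF.orderIsoOfSurjective F F.surjective
  have hmem : F' ∈ periodicReal := mem_periodicReal.2 fun x => by
    change F (x + 2 * π) = F x + 2 * π
    have key : ∀ x y, Circle.exp (F x) = Circle.exp (F y) ↔ Circle.exp x = Circle.exp y :=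
      fun x y => by rw [hlift, hlift, f.injective.eq_iff]
    -- `F` increases by 2πm over a period, with m ≥ 1. The point `s` where it has increased by just
    -- 2π is at least one period away, so m ≤ 1.
    obtain ⟨m, hm⟩ := Circle.exp_eq_exp.1 ((key (x + 2 * π) x).2 (Circle.exp_eq_exp.2 ⟨1, by simp⟩))
    obtain ⟨s, hs⟩ := F.surjective (F x + 2 * π)
    obtain ⟨j, hj⟩ := Circle.exp_eq_exp.1 ((key s x).1 (Circle.exp_eq_exp.2 ⟨1, by simp [hs]⟩))
    have hm0 : (0 : ℝ) < m := by
      have : F x < F (x + 2 * π) := hF (by linarith)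
      by_contra! h
      nlinarith
    have hj0 : (0 : ℝ) < j := by
      have : x < s := hF.lt_iff_lt.1 (by linarith)
      by_contra! h
      nlinarith
    have hm1 : (1 : ℝ) ≤ m := by exact_mod_cast hm0
    have hj1 : (1 : ℝ) ≤ j := by exact_mod_cast hj0
    have hle : F (x + 2 * π) ≤ F s := hF.monotone (by nlinarith)
    nlinarith
  refine ⟨⟨F', hmem⟩, Homeomorph.ext fun z => ?_⟩
  obtain ⟨t, rfl⟩ := Circle.exp_surjective z
  rw [circleHom_exp]
  exact hlift t

theorem Circle.exists_lift (f : Circle ≃ₜ Circle) :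
    ∃ F : ℝ → ℝ, Continuous F ∧ ∀ t, Circle.exp (F t) = f (Circle.exp t) := by
  obtain ⟨s, hs⟩ := Circle.exp_surjective (f (Circle.exp 0))
  obtain ⟨F, ⟨-, hF⟩, -⟩ := Circle.isCoveringMap_exp.existsUnique_continuousMap_lifts
    ((⟨f, f.continuous⟩ : C(Circle, Circle)).comp Circle.exp) 0 s hs
  exact ⟨F, F.continuous, fun t => congrFun hF t⟩

theorem Circle.eq_add_of_exp_eq {F G : ℝ → ℝ} (hF : Continuous F) (hG : Continuous G)
    (h : ∀ t, Circle.exp (F t) = Circle.exp (G t)) : ∃ c, ∀ t, F t = G t + c := by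
  refine ⟨F 0 - G 0, fun t => ?_⟩
  refine congrFun (Circle.isCoveringMap_exp.eq_of_comp_eq (g₁ := F)
    (g₂ := fun t => G t + (F 0 - G 0)) hF (by fun_prop) (funext fun t => ?_) 0 (by simp)) t
  simp [Circle.exp_add, Circle.exp_sub, h]

/-- Lifts of `f` and its inverse are mutually inverse up to constants, so the lift of `f` is
bijective and hence monotone; inversion on the circle negates it. -/
theorem Circle.mem_homeoPlusCircle_or (f : Circle ≃ₜ Circle) :
    f ∈ homeoPlusCircle ∨ Homeomorph.inv Circle * f ∈ homeoPlusCircle := by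
  obtain ⟨F, hFc, hF⟩ := exists_lift f
  obtain ⟨G, hGc, hG⟩ := exists_lift f⁻¹
  obtain ⟨c, hc⟩ := eq_add_of_exp_eq (hGc.comp hFc) continuous_id fun t => by simp [hF, hG]
  obtain ⟨d, hd⟩ := eq_add_of_exp_eq (hFc.comp hGc) continuous_id fun t => by simp [hF, hG]
  have hinj : Function.Injective F := fun x y hxy => by
    have hx := hc x
    have hy := hc y
    simp only [Function.comp_apply, id_eq, hxy] at hx hy
    linarith
  have hsurj : Function.Surjective F := fun y => ⟨G (y - d), by simpa using hd (y - d)⟩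
  rcases hFc.strictMono_of_inj hinj with h | h
  · exact Or.inl ⟨(h.orderIsoOfSurjective F hsurj).toHomeomorph, h, hF⟩
  · have hneg : StrictMono fun x => -F x := fun x y hxy => neg_lt_neg (h hxy)
    refine Or.inr ⟨(hneg.orderIsoOfSurjective _ (neg_surjective.comp hsurj)).toHomeomorph, hneg,
      fun t => ?_⟩
    change Circle.exp (-F t) = (f (Circle.exp t))⁻¹
    rw [Circle.exp_neg, hF]

theorem Circle.inv_notMem_homeoPlusCircle : Homeomorph.inv Circle ∉ homeoPlusCircle := by
  rintro ⟨F, hF, hlift⟩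
  obtain ⟨c, hc⟩ := eq_add_of_exp_eq F.continuous continuous_neg fun t =>
    (hlift t).trans (Circle.exp_neg t).symm
  have := hF zero_lt_one
  rw [hc, hc] at this
  norm_num at this

/-- The identification of `ℝ ≃o ℝ` with the group of increasing homeomorphisms. -/
noncomputable def homeoPlusRealHom : (ℝ ≃o ℝ) →* homeoPlusReal where
  toFun f := ⟨f.toHomeomorph, f.strictMono⟩
  map_one' := rfl
  map_mul' _ _ := rfl

theorem homeoPlusRealHom_surjective : Function.Surjective homeoPlusRealHom := fun f =>
  ⟨StrictMono.orderIsoOfSurjective f.1 f.2 f.1.surjective,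
    Subtype.ext (Homeomorph.ext fun _ => rfl)⟩

theorem mem_homeoPlusReal_or (f : ℝ ≃ₜ ℝ) :
    f ∈ homeoPlusReal ∨ Homeomorph.neg ℝ * f ∈ homeoPlusReal :=
  (f.continuous.strictMono_of_inj f.injective).imp id fun h _ _ hxy => neg_lt_neg (h hxy)

theorem neg_notMem_homeoPlusReal : Homeomorph.neg ℝ ∉ homeoPlusReal := fun h => by
  have : -(0 : ℝ) < -1 := h zero_lt_one
  norm_num at this

end

theorem mainTheorem4 :
    (∀ H : Subgroup (ℝ ≃ₜ ℝ),
      (H ≠ ⊤ ∧ Cardinal.mk ((ℝ ≃ₜ ℝ) ⧸ H) < Cardinal.continuum) ↔ H = homeoPlusReal) ∧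
    (∀ H : Subgroup (Circle ≃ₜ Circle),
      (H ≠ ⊤ ∧ Cardinal.mk ((Circle ≃ₜ Circle) ⧸ H) < Cardinal.continuum) ↔
        H = homeoPlusCircle) ∧
    (∀ H : Subgroup homeoPlusReal,
      Cardinal.mk (homeoPlusReal ⧸ H) < Cardinal.continuum → H = ⊤) := by
  refine ⟨Subgroup.ne_top_and_smallIndex_iff neg_notMem_homeoPlusReal mem_homeoPlusReal_or ?_,
    Subgroup.ne_top_and_smallIndex_iff Circle.inv_notMem_homeoPlusCircle
      Circle.mem_homeoPlusCircle_or ?_, ?_⟩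
  · intro H (hH : H.SmallIndex) f hf
    obtain ⟨g, hg⟩ := homeoPlusRealHom_surjective ⟨f, hf⟩
    have := hH.map_mem (homeoPlusReal.subtype.comp homeoPlusRealHom) g
    rwa [MonoidHom.comp_apply, hg] at this
  · intro H hH f hf
    obtain ⟨F, rfl⟩ := exists_circleHom_eq hf
    exact circleHom_mem hH F
  · intro H (hH : H.SmallIndex)
    refine (Subgroup.eq_top_iff' H).2 fun f => ?_
    obtain ⟨g, rfl⟩ := homeoPlusRealHom_surjective f
    exact hH.map_mem homeoPlusRealHom g
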